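/- Let $q$ be a power of a prime and let $n$ be a positive integer with $\gcd(n,q)=1$ such that the multiplicative order $m=\operatorname{ord}_n(q^2)$ of $q^2$ modulo $n$ satisfies $m\ge 2$. Let $\delta$ be an integer with $$2\le\delta\le\delta_{\max}=\left\lfloor \frac{n(q^m-1)}{q^{2m}-1}\right\rfloor .$$ Then there exist a narrow-sense BCH code $D$ of length $n$ over $\mathbf F_{q^2}$ with designed distance $\delta$ (the cyclic code with generator polynomial $\prod_{z\in Z}(x-\alpha^z)$, where $\alpha$ is a primitive $n$-th root of unity, $Z=C_1\cup\dots\cup C_{\delta-1}$ and $C_x=\{xq^{2k}\bmod n : k\ge 0\}$) that contains its Hermitian dual $D^{\perp_h}=\{y : \sum_i y_i^q x_i=0 \text{ for all } x\in D\}$, and a stabilizer code $\mathcal Q\subseteq(\mathbf C^q)^{\otimes n}$ obtained from $D$ by the Hermitian construction, with parameters $$[[\,n,\; n-2m\lceil(\delta-1)(1-1/q^2)\rceil,\; \ge\delta\,]]_q ,$$ that is pure to $\delta_{\max}+1$. Here, for $a,b\in\mathbf F_q^n$, $X(a)|x\rangle=|x+a\rangle$ and $Z(b)|x\rangle=e^{2\pi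 i\operatorname{tr}(b\cdot x)/p}|x\rangle$, where $p$ is the characteristic of $\mathbf F_q$ and $\operatorname{tr}$ is the trace from $\mathbf F_q$ to $\mathbf F_p$; the weight of an error operator $cX(a)Z(b)$ ($|c|=1$) is the number of $i$ with $(a_i,b_i)\ne(0,0)$; the stabilizer of $\mathcal Q$ is the group of all error operators that fix every vector of $\mathcal Q$, and $\mathcal Q$ is a stabilizer code if it is nonzero and equal to the joint fixed space of its stabilizer. The code $\mathcal Q$ has parameters $[[n,k,\ge d]]_q$ if $\dim\mathcal Q=q^k$ and every error operator $E$ of weight less than $d$ is detectable, i.e. $\langle u,Ev\rangle=\mu_E\langle u,v\rangle$ for all $u,v\in\mathcal Q$ (if $k=0$, moreover $\langle u,Ev\rangle=0$ for non-scalar such $E$). It is pure to $t$ if its stabilizer contains no non-scalar error operator of weight less than $t$. It is obtained from $D$ by the Hermitian construction if, for some basis $\{\beta,\beta^q\}$ of $\mathbf F_{q^2}$ over $\mathbf F_q$, a phase multiple of $X(a)Z(b)$ lies in the stabilizer of $\mathcal Q$ exactly when $\beta a+\beta^q b\in D^{\perp_h}$. -/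

import Mathlib

open Polynomial

noncomputable section

/-! ### Classical codes -/

/-- The `Q`-ary cyclotomic coset `{x Q^k mod n | k ≥ 0}` of `x` modulo `n`. -/
def cyclotomicCoset (n Q x : ℕ) : Finset ℕ :=
  open Classical in (Finset.range n).filter fun y => ∃ k : ℕ, y = x * Q ^ k % n

/-- The set `Z = C_b ∪ C_{b+1} ∪ ⋯ ∪ C_{b+δ-2}`. -/
def bchDefiningSet (n Q b δ : ℕ) : Finset ℕ :=
  (Finset.range (δ - 1)).biUnion fun i => cyclotomicCoset n Q (b + i)

/-- The generator polynomial `∏_{z ∈ Z} (X - α ^ z)`, where `K` is the field of the code and `α`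
lies in an extension `L` of `K`. -/
def bchGenerator (K : Type*) [Field K] [Fintype K] {L : Type*} [Field L]
    (n b δ : ℕ) (α : L) : L[X] :=
  ∏ z ∈ bchDefiningSet n (Fintype.card K) b δ, (X - C (α ^ z))

/-- The polynomial `c_0 + c_1 X + ⋯ + c_{n-1} X^{n-1}` of a word `c`. -/
def wordPoly {K : Type*} [Field K] {n : ℕ} (c : Fin n → K) : K[X] :=
  ∑ i : Fin n, C (c i) * X ^ (i : ℕ)

/-- The BCH code over `K` of length `n` and designed distance `δ` with respect to `α` and the
offset `b`: all words whose polynomial is a multiple of the generator polynomial. Since the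
generator polynomial divides `X ^ n - 1` when `α` is a primitive `n`-th root of unity, this is the
cyclic code that it generates. -/
def bchCode (K : Type*) [Field K] [Fintype K] {L : Type*} [Field L] [Algebra K L]
    (n b δ : ℕ) (α : L) : Submodule K (Fin n → K) where
  carrier := {c | bchGenerator K n b δ α ∣ (wordPoly c).map (algebraMap K L)}
  zero_mem' := by simp [wordPoly]
  add_mem' := by
    intro c d hc hd
    have h : wordPoly (c + d) = wordPoly c + wordPoly d := by
      simp [wordPoly, add_mul, Finset.sum_add_distrib]
    simp only [Set.mem_ofPred_eq] at hc hd ⊢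
    rw [h, Polynomial.map_add]
    exact dvd_add hc hd
  smul_mem' := by
    intro r c hc
    have h : wordPoly (r • c) = C r * wordPoly c := by
      simp [wordPoly, Finset.mul_sum, mul_assoc]
    simp only [Set.mem_ofPred_eq] at hc ⊢
    rw [h, Polynomial.map_mul]
    exact Dvd.dvd.mul_left hc _

/-- `D` is a narrow-sense (`b = 1`) BCH code of length `n` and designed distance `δ` over `K`. -/
def IsNarrowSenseBCH {K : Type*} [Field K] [Fintype K] (n δ : ℕ)
    (D : Submodule K (Fin n → K)) : Prop :=
  ∃ α : AlgebraicClosure K, IsPrimitiveRoot α n ∧ D = bchCode K n 1 δ α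

/-- The Hermitian dual `{y | ∑ y_i ^ q x_i = 0 for all x ∈ D}` of a code `D` over the
quadratic extension `K` of the field `F` with `q` elements. -/
def hermitianDual (F : Type*) {K : Type*} [Field F] [Fintype F] [Field K] [Algebra F K] {n : ℕ}
    (D : Submodule K (Fin n → K)) : Submodule K (Fin n → K) where
  carrier := {y | ∀ x ∈ D, ∑ i, y i ^ Fintype.card F * x i = 0}
  zero_mem' := by
    intro x _
    simp [Fintype.card_ne_zero]
  add_mem' := by
    intro y z hy hz x hx
    have h : ∀ u v : K, (u + v) ^ Fintype.card F = u ^ Fintype.card F + v ^ Fintype.card F :=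
      fun u v => map_add (FiniteField.frobeniusAlgHom F K) u v
    simp [h, add_mul, Finset.sum_add_distrib, hy x hx, hz x hx]
  smul_mem' := by
    intro r y hy x hx
    simp only [Pi.smul_apply, smul_eq_mul, mul_pow, mul_assoc]
    rw [← Finset.mul_sum, hy x hx, mul_zero]

/-! ### Quantum codes -/

/-- The state space `(ℂ^q)^{⊗ n} = ℂ^(q^n)` of `n` systems of dimension `q = |F|`, with orthonormal
basis indexed by the words in `F ^ n`. -/
abbrev QState (F : Type*) [Fintype F] (n : ℕ) := EuclideanSpace ℂ (Fin n → F)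

instance ringCharNeZero (F : Type*) [Field F] [Fintype F] : NeZero (ringChar F) :=
  ⟨CharP.ringChar_ne_zero_of_finite F⟩

/-- The additive character `x ↦ exp (2 π i tr(x) / p)` of the finite field `F` of characteristic
`p`, where `tr` is the trace from `F` to the prime field. -/
def traceChar (F : Type*) [Field F] [Fintype F] : AddChar F ℂ :=
  letI : Algebra (ZMod (ringChar F)) F := ZMod.algebra F (ringChar F)
  (ZMod.stdAddChar (N := ringChar F)).compAddMonoidHom
    (Algebra.trace (ZMod (ringChar F)) F).toAddMonoidHom

variable {F : Type*} [Field F] [Fintype F] {n : ℕ}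

/-- The shift operator `X(a)`, with `X(a)|x⟩ = |x + a⟩`. -/
def opX (a : Fin n → F) : QState F n →ₗ[ℂ] QState F n where
  toFun ψ := WithLp.toLp 2 fun x => ψ (x - a)
  map_add' _ _ := rfl
  map_smul' _ _ := rfl

/-- The phase operator `Z(b)`, with `Z(b)|x⟩ = exp (2 π i tr(b · x) / p) |x⟩`. -/
def opZ (b : Fin n → F) : QState F n →ₗ[ℂ] QState F n where
  toFun ψ := WithLp.toLp 2 fun x => traceChar F (∑ i, b i * x i) * ψ x
  map_add' φ ψ := by ext x; simp [mul_add]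
  map_smul' r ψ := by ext x; simp [mul_left_comm]

/-- The error operator `c X(a) Z(b)`. -/
def errorOp (c : ℂ) (a b : Fin n → F) : QState F n →ₗ[ℂ] QState F n :=
  c • (opX a ∘ₗ opZ b)

/-- The weight of the error `c X(a) Z(b)`: the number of tensor factors that are not scalar. -/
def errorWeight (a b : Fin n → F) : ℕ :=
  Nat.card {i : Fin n // a i ≠ 0 ∨ b i ≠ 0}

/-- The stabilizer of `Q`: all error operators `c X(a) Z(b)`, `|c| = 1`, that fix `Q` pointwise. -/
def codeStabilizer (Q : Submodule ℂ (QState F n)) : Set (QState F n →ₗ[ℂ] QState F n) :=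
  {E | (∃ (c : ℂ) (a b : Fin n → F), ‖c‖ = 1 ∧ E = errorOp c a b) ∧ ∀ v ∈ Q, E v = v}

/-- A stabilizer code is a nonzero subspace that is the joint fixed space of its stabilizer. -/
def IsStabilizerCode (Q : Submodule ℂ (QState F n)) : Prop :=
  Q ≠ ⊥ ∧ ∀ v : QState F n, v ∈ Q ↔ ∀ E ∈ codeStabilizer Q, E v = v

/-- `Q` detects the error `E`: `⟨u, E v⟩ = μ ⟨u, v⟩` on `Q`, for a scalar `μ` that depends on `E`
only. -/
def Detects (Q : Submodule ℂ (QState F n)) (E : QState F n →ₗ[ℂ] QState F n) : Prop :=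
  ∃ μ : ℂ, ∀ u ∈ Q, ∀ v ∈ Q, inner ℂ u (E v) = μ * inner ℂ u v

/-- The minimum distance of `Q` is at least `d`: `Q` detects every error of weight less than `d`.
By the usual convention a one-dimensional code, which detects everything, has to satisfy
`⟨u, E v⟩ = 0` for all non-scalar errors of weight less than `d`. -/
def MinDistAtLeast (Q : Submodule ℂ (QState F n)) (d : ℕ) : Prop :=
  (∀ a b : Fin n → F, errorWeight a b < d → Detects Q (errorOp 1 a b)) ∧
  (Module.finrank ℂ Q = 1 → ∀ a b : Fin n → F, 0 < errorWeight a b → errorWeight a b < d →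
    ∀ u ∈ Q, ∀ v ∈ Q, inner ℂ u (errorOp 1 a b v) = 0)

/-- `Q` is pure to `t`: its stabilizer contains no non-scalar error of weight less than `t`. -/
def PureTo (Q : Submodule ℂ (QState F n)) (t : ℕ) : Prop :=
  ∀ (c : ℂ) (a b : Fin n → F), errorOp c a b ∈ codeStabilizer Q → (a ≠ 0 ∨ b ≠ 0) →
    t ≤ errorWeight a b

/-- `Q` arises from the code `D` over the quadratic extension `K` of `F` by the Hermitian
construction: for some normal basis `β, β ^ q` of `K` over `F`, the errors `X(a) Z(b)` that lie in
the stabilizer of `Q` up to a phase are those with `β a + β ^ q b` in the Hermitian dual of `D`. -/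
def IsHermitianConstruction {K : Type*} [Field K] [Algebra F K]
    (D : Submodule K (Fin n → K)) (Q : Submodule ℂ (QState F n)) : Prop :=
  ∃ β : K, LinearIndependent F ![β, β ^ Fintype.card F] ∧
    ∀ a b : Fin n → F,
      (∃ c : ℂ, errorOp c a b ∈ codeStabilizer Q) ↔
        (fun i => a i • β + b i • β ^ Fintype.card F) ∈ hermitianDual F D

end

/-! Put M = δmax. The definition of δmax amounts to M(q^m + 1) ≤ n, so for x, y < M and f ≤ m the
numbers y q^f and x + y q^f stay below n once y > 0, and congruences between such numbers are
equalities. This has three consequences. By `eq_of_modEq_mul_pow`, every x < δ prime to being a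
multiple of q², that is with q² ∤ x, contributes a coset of exactly m elements, and these cosets are
disjoint; this gives dim D. By `not_dvd_add_mul_pow_odd`, Z is disjoint from -qZ modulo n, which
gives D^{⊥h} ≤ D. By the same lemma, words of D^{⊥h} vanish at α^0, …, α^(M-1), so the BCH bound
makes their nonzero weights exceed M.

On the quantum side, X(a)Z(b) corresponds to the word βa + β^q b. Commutators are traces of the
symplectic form, and that form is the skew part of the Hermitian form up to a nonzero factor
(`hermitian_sub_swap_eq`). Hence D^{⊥h} yields commuting errors; 𝒬 is a joint eigenspace of them,
and the trace of its projector gives its dimension. A nonscalar error of weight below δ has its word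
outside D by the BCH bound, so it fails to commute with some stabilizer element and is detected. -/

/-! ### Arithmetic of cyclotomic cosets. -/

theorem mem_bchDefiningSet {n Q b δ z : ℕ} (hn : 0 < n) :
    z ∈ bchDefiningSet n Q b δ ↔ ∃ i < δ - 1, ∃ k, z = (b + i) * Q ^ k % n := by
  simp only [bchDefiningSet, cyclotomicCoset, Finset.mem_biUnion, Finset.mem_range,
    Finset.mem_filter]
  constructor
  · rintro ⟨i, hi, _, k, rfl⟩
    exact ⟨i, hi, k, rfl⟩
  · rintro ⟨i, hi, k, rfl⟩
    exact ⟨i, hi, Nat.mod_lt _ hn, k, rfl⟩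

theorem mem_bchDefiningSet_one {n Q δ z : ℕ} (hn : 0 < n) :
    z ∈ bchDefiningSet n Q 1 δ ↔ ∃ x, 0 < x ∧ x < δ ∧ ∃ k, z = x * Q ^ k % n := by
  rw [mem_bchDefiningSet hn]
  constructor
  · rintro ⟨i, hi, k, rfl⟩
    exact ⟨1 + i, by omega, by omega, k, rfl⟩
  · rintro ⟨x, hx, hx', k, rfl⟩
    exact ⟨x - 1, by omega, k, by rw [Nat.add_sub_cancel' hx]⟩

theorem pow_modEq_one_of_dvd {n q m e : ℕ} (h : q ^ m ≡ 1 [MOD n]) (hd : m ∣ e) :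
    q ^ e ≡ 1 [MOD n] := by
  obtain ⟨c, rfl⟩ := hd
  simpa [pow_mul] using h.pow c

theorem pow_modEq_pow_mod {n q m : ℕ} (h : q ^ m ≡ 1 [MOD n]) (e : ℕ) :
    q ^ e ≡ q ^ (e % m) [MOD n] := by
  conv_lhs => rw [← Nat.mod_add_div e m, pow_add]
  simpa using (Nat.ModEq.refl (q ^ (e % m))).mul (pow_modEq_one_of_dvd h (dvd_mul_right m (e / m)))

/-- Small residues `x` and `y` have no relation `x + y q ^ e ≡ 0` with `e` odd. -/
theorem not_dvd_add_mul_pow_odd {n q m M x y e : ℕ} (h : q ^ (2 * m) ≡ 1 [MOD n]) (hq : 0 < q)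
    (hm : 0 < m) (hM : M * (q ^ m + 1) ≤ n) (hy0 : 0 < y) (hx : x < M) (hy : y < M)
    (he : Odd e) : ¬ n ∣ x + y * q ^ e := by
  have small : ∀ u v f, u + v ≠ 0 → u < M → v < M → f ≤ m → ¬ n ∣ u + v * q ^ f := by
    intro u v f h0 hu hv hf hd
    have h1 : v * q ^ f ≤ M * q ^ m := Nat.mul_le_mul hv.le (Nat.pow_le_pow_right hq hf)
    have h2 : u + v * q ^ f < n := by linarith [mul_add M (q ^ m) 1]
    have h3 := Nat.eq_zero_of_dvd_of_lt hd h2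
    have h4 : 0 < q ^ f := pow_pos hq f
    have h5 : v * q ^ f = 0 := by omega
    rcases Nat.mul_eq_zero.1 h5 with h6 | h6 <;> omega
  intro hd
  set f := e % (2 * m) with hf
  have hfo : f % 2 = 1 := by
    rw [hf, Nat.mod_mul_right_mod]
    exact Nat.odd_iff.1 he
  have hflt : f < 2 * m := Nat.mod_lt _ (by omega)
  have hdf : x + y * q ^ f ≡ 0 [MOD n] :=
    (((pow_modEq_pow_mod h e).symm.mul_left y).add_left x).trans
      ((Nat.modEq_zero_iff_dvd).2 hd)
  rcases le_or_gt f m with hle | hgt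
  · exact small x y f (by omega) hx hy hle ((Nat.modEq_zero_iff_dvd).1 hdf)
  -- Multiplying by q^(2m-f) exchanges the roles of x and y and brings the exponent below m.
  · refine small y x (2 * m - f) (by omega) hy hx (by omega) ((Nat.modEq_zero_iff_dvd).1 ?_)
    have h1 := hdf.mul_right (q ^ (2 * m - f))
    rw [zero_mul, add_mul, mul_assoc, ← pow_add, Nat.add_sub_cancel' hflt.le] at h1
    have h2 := (h.mul_left y).add_left (x * q ^ (2 * m - f))
    rw [mul_one] at h2
    rw [add_comm]
    exact h2.symm.trans h1

/-- If 2t ≤ m, both sides are below n, hence equal, and q² ∤ x forces t = 0. Otherwise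
multiplication by q^(2(m-t)) gives the same situation with x and y exchanged, and m - t = 0 is
absurd. -/
theorem eq_of_modEq_mul_pow {n q m M x y t : ℕ} (h : (q ^ 2) ^ m ≡ 1 [MOD n]) (hq : 0 < q)
    (hM : M * (q ^ m + 1) ≤ n) (hx : x < M) (hy : y < M) (hxq : ¬ q ^ 2 ∣ x) (hyq : ¬ q ^ 2 ∣ y)
    (ht : t < m) (hxy : x ≡ y * (q ^ 2) ^ t [MOD n]) : t = 0 ∧ x = y := by
  have small : ∀ u v f, u < M → v < M → 2 * f ≤ m → ¬ q ^ 2 ∣ u → u ≡ v * (q ^ 2) ^ f [MOD n] →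
      f = 0 ∧ u = v := by
    intro u v f hu hv hf huq huv
    have h1 : v * q ^ (2 * f) ≤ M * q ^ m := Nat.mul_le_mul hv.le (Nat.pow_le_pow_right hq hf)
    have h2 : v * (q ^ 2) ^ f < n := by rw [← pow_mul]; linarith [mul_add M (q ^ m) 1]
    have h4 : M ≤ n := (Nat.le_mul_of_pos_right M (Nat.succ_pos _)).trans hM
    have h3 : u = v * (q ^ 2) ^ f := Nat.ModEq.eq_of_lt_of_lt huv (by omega) h2
    have hf0 : f = 0 := by
      by_contra hf0
      exact huq (h3 ▸ Dvd.dvd.mul_left (dvd_pow_self _ hf0) _)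
    subst hf0
    exact ⟨rfl, by simpa using h3⟩
  rcases le_or_gt (2 * t) m with hle | hgt
  · exact small x y t hx hy hle hxq hxy
  · have h1 := hxy.mul_right ((q ^ 2) ^ (m - t))
    rw [mul_assoc, ← pow_add, Nat.add_sub_cancel' ht.le] at h1
    have h2 := h.mul_left y
    rw [mul_one] at h2
    have := small y x (m - t) hy hx (by omega) hyq (h1.trans h2).symm
    omega

/-- Since x and q²x have the same coset, only the x < δ with q² ∤ x are needed; their cosets are
disjoint and have m elements each. -/
theorem card_bchDefiningSet_one {n q m M δ : ℕ} (h : (q ^ 2) ^ m ≡ 1 [MOD n]) (hq : 2 ≤ q)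
    (hm : 0 < m) (hM : M * (q ^ m + 1) ≤ n) (hδM : δ ≤ M) (hn : 0 < n) :
    (bchDefiningSet n (q ^ 2) 1 δ).card = m * ((δ - 1) - (δ - 1) / q ^ 2) := by
  set A := {x ∈ Finset.Ioc 0 (δ - 1) | ¬ q ^ 2 ∣ x} with hA
  have hcop : ∀ i, Nat.gcd n ((q ^ 2) ^ i) = 1 := fun i => by
    have : Nat.Coprime n ((q ^ 2) ^ m) := by
      rw [Nat.coprime_comm, Nat.Coprime, h.gcd_eq, Nat.gcd_one_left]
    exact Nat.Coprime.pow_right i (Nat.Coprime.coprime_dvd_right (dvd_pow_self _ hm.ne') this)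
  have himg : bchDefiningSet n (q ^ 2) 1 δ =
      (A ×ˢ Finset.range m).image fun p => p.1 * (q ^ 2) ^ p.2 % n := by
    ext z
    simp only [mem_bchDefiningSet_one hn, Finset.mem_image, Finset.mem_product, hA,
      Finset.mem_filter, Finset.mem_Ioc, Finset.mem_range, Prod.exists]
    constructor
    · rintro ⟨x, hx0, hx, k, rfl⟩
      obtain ⟨a, x', hx', rfl⟩ :=
        Nat.exists_eq_pow_mul_and_not_dvd hx0.ne' (q ^ 2) (by nlinarith)
      have hpos : 0 < x' := Nat.pos_of_ne_zero fun h0 => hx' (h0 ▸ dvd_zero _)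
      have hle : x' ≤ (q ^ 2) ^ a * x' := Nat.le_mul_of_pos_left _ (by positivity)
      refine ⟨x', (a + k) % m, ⟨⟨⟨hpos, by omega⟩, hx'⟩, Nat.mod_lt _ hm⟩, ?_⟩
      have := (pow_modEq_pow_mod h (a + k)).symm.mul_left x'
      rw [pow_add, mul_left_comm, ← mul_assoc] at this
      exact this
    · rintro ⟨x, k, ⟨⟨⟨hx0, hx⟩, -⟩, -⟩, rfl⟩
      exact ⟨x, hx0, by omega, k, rfl⟩
  have key : ∀ x y i j, x ∈ A → y ∈ A → i ≤ j → j < m →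
      x * (q ^ 2) ^ i ≡ y * (q ^ 2) ^ j [MOD n] → x = y ∧ i = j := by
    intro x y i j hx hy hij hj hxy
    simp only [hA, Finset.mem_filter, Finset.mem_Ioc] at hx hy
    have h1 : x ≡ y * (q ^ 2) ^ (j - i) [MOD n] := by
      refine Nat.ModEq.cancel_right_of_coprime (hcop i) ?_
      rwa [mul_assoc, ← pow_add, Nat.sub_add_cancel hij]
    have := eq_of_modEq_mul_pow h (by omega) hM (by omega) (by omega) hx.2 hy.2 (by omega) h1
    omega
  rw [himg, Finset.card_image_of_injOn, Finset.card_product, Finset.card_range, mul_comm]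
  · congr 1
    have h1 : (δ - 1) / q ^ 2 + A.card = δ - 1 := by
      rw [← Nat.Ioc_filter_dvd_card_eq_div, hA]
      convert Finset.card_filter_add_card_filter_not (s := Finset.Ioc 0 (δ - 1))
        (fun x => q ^ 2 ∣ x)
      simp
    exact Nat.eq_sub_of_add_eq' h1
  · rintro ⟨x, i⟩ hx ⟨y, j⟩ hy hxy
    simp only [Finset.coe_product, Set.mem_prod, Finset.mem_coe, Finset.mem_range] at hx hy hxy
    rcases le_total i j with hij | hij
    · obtain ⟨rfl, rfl⟩ := key x y i j hx.1 hy.1 hij hy.2 hxy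
      rfl
    · obtain ⟨rfl, rfl⟩ := key y x j i hy.1 hx.1 hij hx.2 (Nat.ModEq.symm hxy)
      rfl

theorem ceil_mul_one_sub_one_div (d Q : ℕ) (hd : 1 ≤ d) :
    ⌈((d : ℚ) - 1) * (1 - 1 / (Q : ℚ))⌉ = ((d - 1 - (d - 1) / Q : ℕ) : ℤ) := by
  have h1 : ((d : ℚ) - 1) * (1 - 1 / (Q : ℚ)) = ((d - 1 : ℕ) : ℤ) - ((d - 1 : ℕ) : ℚ) / (Q : ℚ) := by
    push_cast [Nat.cast_sub hd]
    ring
  have h2 := Rat.floor_natCast_div_natCast (d - 1) Q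
  rw [h1, sub_eq_add_neg, Int.ceil_intCast_add, Int.ceil_neg, h2, Nat.cast_sub (Nat.div_le_self _ _)]
  push_cast
  ring

/-! ### BCH codes: weight, generator polynomial, dimension. -/

/-- X^|K| - X is already the product of the X - a with a in K, so it has no further roots in L. -/
theorem FiniteField.mem_range_algebraMap_of_pow_card_eq {K L : Type*} [Field K] [Fintype K]
    [Field L] [Algebra K L] {x : L} (hx : x ^ Fintype.card K = x) :
    x ∈ Set.range (algebraMap K L) := by
  have hK := Fintype.one_lt_card (α := K)
  have h1 : (Multiset.map (fun a => X - C a) (X ^ Fintype.card K - X : K[X]).roots).prod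
      = X ^ Fintype.card K - X := by
    refine prod_multiset_X_sub_C_of_monic_of_roots_card_eq
      (monic_X_pow_sub (by rw [degree_X]; exact_mod_cast hK)) ?_
    rw [FiniteField.roots_X_pow_card_sub_X, FiniteField.X_pow_card_sub_X_natDegree_eq _ hK]
    rfl
  rw [FiniteField.roots_X_pow_card_sub_X] at h1
  change ∏ a : K, (X - C a) = _ at h1
  have h2 := congrArg (aeval x) h1
  rw [map_prod] at h2
  simp only [map_sub, map_pow, aeval_X, aeval_C, hx, sub_self] at h2
  obtain ⟨a, -, ha⟩ := Finset.prod_eq_zero_iff.1 h2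
  exact ⟨a, (sub_eq_zero.1 ha).symm⟩

/-- The **BCH bound**: a nonzero word with `d` consecutive zeros has weight greater than `d`. -/
theorem lt_card_support_of_consecutive_zeros {L : Type*} [Field L] {n b d : ℕ} {α : L}
    (hα : IsPrimitiveRoot α n) {c : Fin n → L} (hc : c ≠ 0)
    (h : ∀ j < d, ∑ i, c i * (α ^ (b + j)) ^ (i : ℕ) = 0) :
    d < Nat.card {i // c i ≠ 0} := by
  classical
  rw [Nat.card_eq_fintype_card, Fintype.card_subtype]
  set s : Finset (Fin n) := {i | c i ≠ 0}
  obtain ⟨i₀, hi₀⟩ := Function.ne_iff.1 hc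
  have hi₀s : i₀ ∈ s := by simpa [s] using hi₀
  by_contra! hd
  -- P replaces the Vandermonde determinant. Its degree is below d, so combining the d zero
  -- conditions with its coefficients gives ∑ c_i α^(bi) P(α^i) = 0, where only the term at i₀
  -- survives.
  set P : L[X] := ∏ i ∈ s.erase i₀, (X - C (α ^ (i : ℕ))) with hP
  have hdeg : P.natDegree < d := by
    rw [hP, natDegree_prod_of_monic _ _ fun i _ => monic_X_sub_C _]
    simp only [natDegree_X_sub_C, Finset.sum_const, smul_eq_mul, mul_one]
    exact (Finset.card_erase_lt_of_mem hi₀s).trans_le hd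
  have hsum : ∑ i, c i * (α ^ b) ^ (i : ℕ) * P.eval (α ^ (i : ℕ)) = 0 := by
    simp_rw [eval_eq_sum_range' hdeg, Finset.mul_sum]
    rw [Finset.sum_comm]
    refine Finset.sum_eq_zero fun j hj => ?_
    rw [← mul_zero (P.coeff j), ← h j (Finset.mem_range.1 hj), Finset.mul_sum]
    refine Finset.sum_congr rfl fun i _ => ?_
    rw [pow_add, mul_pow, pow_right_comm α j]
    ring
  rw [Finset.sum_eq_single i₀] at hsum
  · have hα0 : α ≠ 0 := hα.ne_zero (by have := i₀.2; omega)
    refine mul_ne_zero (mul_ne_zero hi₀ (pow_ne_zero _ (pow_ne_zero _ hα0))) ?_ hsum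
    rw [hP, eval_prod, Finset.prod_ne_zero_iff]
    intro i hi hz
    rw [eval_sub, eval_X, eval_C, sub_eq_zero] at hz
    exact Finset.ne_of_mem_erase hi (Fin.ext (hα.pow_inj i₀.2 i.2 hz).symm)
  · intro i _ hi
    by_cases hci : c i = 0
    · simp [hci]
    · have : P.eval (α ^ (i : ℕ)) = 0 := by
        rw [hP, eval_prod]
        exact Finset.prod_eq_zero (i := i) (by simp [s, hi, hci]) (by simp)
      rw [this, mul_zero]
  · simp

theorem lt_of_mem_bchDefiningSet {n Q b δ z : ℕ} (h : z ∈ bchDefiningSet n Q b δ) : z < n := by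
  simp only [bchDefiningSet, cyclotomicCoset, Finset.mem_biUnion, Finset.mem_range,
    Finset.mem_filter] at h
  obtain ⟨i, hi, hz, -⟩ := h
  exact hz

theorem bchGenerator_monic {K L : Type*} [Field K] [Fintype K] [Field L] {n b δ : ℕ} {α : L} :
    (bchGenerator K n b δ α).Monic :=
  monic_prod_X_sub_C _ _

theorem natDegree_bchGenerator {K L : Type*} [Field K] [Fintype K] [Field L] {n b δ : ℕ} {α : L} :
    (bchGenerator K n b δ α).natDegree =
    (bchDefiningSet n (Fintype.card K) b δ).card := by
  rw [bchGenerator, natDegree_prod_of_monic _ _ fun i _ => monic_X_sub_C _]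
  simp only [natDegree_X_sub_C, Finset.sum_const, smul_eq_mul, mul_one]

theorem bchGenerator_dvd_iff {K L : Type*} [Field K] [Fintype K] [Field L] {n b δ : ℕ} {α : L}
    (hα : IsPrimitiveRoot α n) {p : L[X]} :
    bchGenerator K n b δ α ∣ p ↔
      ∀ z ∈ bchDefiningSet n (Fintype.card K) b δ, p.eval (α ^ z) = 0 := by
  constructor
  · intro h z hz
    refine eval_eq_zero_of_dvd_of_eval_eq_zero h ?_
    rw [bchGenerator, eval_prod]
    exact Finset.prod_eq_zero hz (by simp)
  · intro h
    refine Finset.prod_dvd_of_coprime ?_ fun z hz => dvd_iff_isRoot.2 (h z hz)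
    intro y hy z hz hyz
    have hne : α ^ y ≠ α ^ z := fun h0 => hyz
      (hα.pow_inj (lt_of_mem_bchDefiningSet hy) (lt_of_mem_bchDefiningSet hz) h0)
    exact isCoprime_X_sub_C_of_isUnit_sub (sub_ne_zero.2 hne).isUnit

theorem eval_map_wordPoly {K L : Type*} [Field K] [Field L] [Algebra K L] {n : ℕ} (c : Fin n → K) (x : L) :
    ((wordPoly c).map (algebraMap K L)).eval x = ∑ i, algebraMap K L (c i) * x ^ (i : ℕ) := by
  simp [wordPoly, Polynomial.map_sum, eval_finsetSum]

theorem wordPoly_coeff_of_natDegree_lt {K : Type*} [Field K] {n : ℕ} {p : K[X]} (hp : p.natDegree < n) :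
    wordPoly (fun i : Fin n => p.coeff i) = p := by
  conv_rhs => rw [p.as_sum_range_C_mul_X_pow' hp]
  exact Fin.sum_univ_eq_sum_range (fun i => C (p.coeff i) * X ^ i) n

theorem coeff_wordPoly {K : Type*} [Field K] {n : ℕ} (c : Fin n → K) (i : Fin n) : (wordPoly c).coeff i = c i := by
  simp [wordPoly, finsetSum_coeff, coeff_C_mul, coeff_X_pow, Fin.val_inj]

section Generator

variable {K L : Type*} [Field K] [Fintype K] [Field L] [Algebra K L] {n b δ : ℕ} {α : L}

/-- Multiplication by |K| permutes the defining set modulo n, so the Frobenius of K fixes the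
coefficients. -/
theorem exists_map_eq_bchGenerator (hα : IsPrimitiveRoot α n) (hn : 0 < n) :
    ∃ g : K[X], g.map (algebraMap K L) = bchGenerator K n b δ α ∧
      g.natDegree = (bchDefiningSet n (Fintype.card K) b δ).card ∧ g.Monic := by
  rw [← natDegree_bchGenerator (α := α)]
  refine lifts_and_natDegree_eq_and_monic ?_ bchGenerator_monic
  rw [lifts_iff_coeff_lifts]
  intro j
  apply FiniteField.mem_range_algebraMap_of_pow_card_eq
  let φ : L →+* L := (FiniteField.frobeniusAlgHom K L).toRingHom
  have hφ : ∀ x, φ x = x ^ Fintype.card K := fun x => rfl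
  suffices (bchGenerator K n b δ α).map φ = bchGenerator K n b δ α by
    conv_rhs => rw [← this, coeff_map, hφ]
  set Z := bchDefiningSet n (Fintype.card K) b δ with hZ
  have hred : ∀ z, φ (α ^ z) = α ^ (z * Fintype.card K % n) := fun z => by
    rw [hφ, ← pow_mul, ← pow_mod_orderOf, ← hα.eq_orderOf]
  have hinj : Set.InjOn (fun z => z * Fintype.card K % n) Z := by
    intro y hy z hz hyz
    refine hα.pow_inj (lt_of_mem_bchDefiningSet hy) (lt_of_mem_bchDefiningSet hz) (φ.injective ?_)
    rw [hred, hred]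
    exact congrArg _ hyz
  have himg : Z.image (fun z => z * Fintype.card K % n) = Z := by
    refine Finset.eq_of_subset_of_card_le ?_ (Finset.card_image_of_injOn hinj).ge
    intro y hy
    obtain ⟨z, hz, rfl⟩ := Finset.mem_image.1 hy
    obtain ⟨i, hi, k, rfl⟩ := (mem_bchDefiningSet hn).1 hz
    refine (mem_bchDefiningSet hn).2 ⟨i, hi, k + 1, ?_⟩
    rw [Nat.mod_mul_mod, pow_succ, mul_assoc]
  simp only [bchGenerator, Polynomial.map_prod, Polynomial.map_sub, map_X, map_C, hred]
  rw [← hZ]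
  conv_rhs => rw [← himg, Finset.prod_image hinj]

theorem mem_bchCode_iff (hα : IsPrimitiveRoot α n) {c : Fin n → K} :
    c ∈ bchCode K n b δ α ↔ ∀ z ∈ bchDefiningSet n (Fintype.card K) b δ,
      ∑ i, algebraMap K L (c i) * (α ^ z) ^ (i : ℕ) = 0 := by
  simp_rw [← eval_map_wordPoly]
  exact bchGenerator_dvd_iff hα

/-- The code is the kernel of reduction modulo g on polynomials of degree below n. The reduction is
onto K[X]/(g), as deg g ≤ n leaves room for all remainders. -/
theorem finrank_bchCode (hα : IsPrimitiveRoot α n) (hn : 0 < n) :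
    Module.finrank K (bchCode K n b δ α) + (bchDefiningSet n (Fintype.card K) b δ).card = n := by
  obtain ⟨g, hg, hdeg, hmon⟩ := exists_map_eq_bchGenerator (K := K) (b := b) (δ := δ) hα hn
  let W : (Fin n → K) →ₗ[K] K[X] :=
    { toFun := wordPoly
      map_add' := fun c d => by simp [wordPoly, add_mul, Finset.sum_add_distrib]
      map_smul' := fun r c => by simp [wordPoly, Finset.smul_sum, smul_eq_C_mul, mul_assoc] }
  let T := (AdjoinRoot.mkₐ g).toLinearMap ∘ₗ W
  have hT : ∀ c, T c = AdjoinRoot.mk g (wordPoly c) := fun c => rfl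
  have hker : LinearMap.ker T = bchCode K n b δ α := by
    ext c
    rw [LinearMap.mem_ker, hT, AdjoinRoot.mk_eq_zero, ← map_dvd_map' (algebraMap K L), hg]
    rfl
  have hle : g.natDegree ≤ n := by
    rw [hdeg]
    simpa using Finset.card_le_card
      (fun z hz => Finset.mem_range.2 (lt_of_mem_bchDefiningSet hz) :
        bchDefiningSet n (Fintype.card K) b δ ⊆ Finset.range n)
  have hsurj : LinearMap.range T = ⊤ := by
    rw [LinearMap.range_eq_top]
    intro y
    obtain ⟨p, rfl⟩ := AdjoinRoot.mk_surjective y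
    have hlt : (p %ₘ g).natDegree < n := by
      by_cases h1 : g = 1
      · simpa [h1] using hn
      · exact (natDegree_modByMonic_lt p hmon h1).trans_le hle
    refine ⟨fun i => (p %ₘ g).coeff i, ?_⟩
    rw [hT, wordPoly_coeff_of_natDegree_lt hlt, AdjoinRoot.mk_eq_mk]
    exact ⟨-(p /ₘ g), by linear_combination modByMonic_add_div p g⟩
  have h := LinearMap.finrank_range_add_finrank_ker T
  rw [hker, hsurj, finrank_top, (AdjoinRoot.powerBasis' hmon).finrank,
    Module.finrank_fintype_fun_eq_card, Fintype.card_fin, AdjoinRoot.powerBasis'_dim, hdeg] at h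
  omega

end Generator

/-! ### Hermitian duals and their zeros. -/

section Duals

variable {F K : Type*} [Field F] [Fintype F] [Field K] [Fintype K] [Algebra F K] {n : ℕ}

/-- The coordinatewise Frobenius y ↦ y^q maps the Hermitian dual bijectively to the Euclidean dual.
It is only semilinear over K, so cardinalities are compared. -/
theorem finrank_add_finrank_hermitianDual (D : Submodule K (Fin n → K)) :
    Module.finrank K D + Module.finrank K (hermitianDual F D) = n := by
  let E : Submodule K (Fin n → K) :=
    D.dualAnnihilator.comap (dotProductEquiv K (Fin n)).toLinearMap
  have hE : ∀ y, y ∈ E ↔ ∀ x ∈ D, ∑ i, y i * x i = 0 := fun y => by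
    rw [Submodule.mem_comap, Submodule.mem_dualAnnihilator]
    rfl
  have hfE : Module.finrank K E = Module.finrank K D.dualAnnihilator :=
    (LinearEquiv.ofSubmodule' (dotProductEquiv K (Fin n)) _).finrank_eq
  let σ := FiniteField.frobeniusAlgEquivOfAlgebraic F K
  have hcard : Nat.card (hermitianDual F D) = Nat.card E := by
    refine Nat.card_congr ((Equiv.piCongrRight fun _ => σ.toEquiv).subtypeEquiv fun y => ?_)
    rw [hE]
    rfl
  rw [Module.natCard_eq_pow_finrank (K := K) (V := hermitianDual F D),
    Module.natCard_eq_pow_finrank (K := K) (V := E)] at hcard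
  have := Nat.pow_right_injective (Nat.card_eq_fintype_card (α := K) ▸ Fintype.one_lt_card) hcard
  rw [this, hfE, Subspace.finrank_add_finrank_dualAnnihilator_eq]
  simp

theorem hermitianDual_hermitianDual (hK : Fintype.card K = Fintype.card F ^ 2)
    (D : Submodule K (Fin n → K)) : hermitianDual F (hermitianDual F D) = D := by
  symm
  apply Submodule.eq_of_le_of_finrank_eq
  · intro x hx y hy
    let φ : K →ₐ[F] K := FiniteField.frobeniusAlgHom F K
    have h := congrArg φ (hy x hx)
    rw [map_sum, map_zero] at h
    rw [← h]
    refine Finset.sum_congr rfl fun i _ => ?_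
    change _ = (y i ^ Fintype.card F * x i) ^ Fintype.card F
    rw [mul_pow, ← pow_mul, ← sq, ← hK, FiniteField.pow_card, mul_comm]
  · have h1 := finrank_add_finrank_hermitianDual (F := F) D
    have h2 := finrank_add_finrank_hermitianDual (F := F) (hermitianDual F D)
    omega

/-- The zeros of the Hermitian dual of a BCH code. -/
theorem sum_mul_pow_eq_zero_of_mem_hermitianDual {L : Type*} [Field L] [Algebra K L] {b δ : ℕ}
    {α : L} (hα : IsPrimitiveRoot α n) (hn : 0 < n) {y : Fin n → K}
    (hy : y ∈ hermitianDual F (bchCode K n b δ α)) {w : ℕ}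
    (hw : ∀ z ∈ bchDefiningSet n (Fintype.card K) b δ, ¬ n ∣ w * Fintype.card F + z) :
    ∑ i, algebraMap K L (y i) * (α ^ w) ^ (i : ℕ) = 0 := by
  obtain ⟨g, hg, -, hmon⟩ := exists_map_eq_bchGenerator (K := K) (b := b) (δ := δ) hα hn
  set β := α ^ (w * Fintype.card F) with hβ
  set V : L[X] := wordPoly fun i : Fin n => β ^ (i : ℕ) with hV
  -- At α^z, V is the geometric sum of the n-th root of unity βα^z, which differs from 1 by `hw`.
  have hdvd : g.map (algebraMap K L) ∣ V := by
    rw [hg, bchGenerator_dvd_iff hα]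
    intro z hz
    have h1 : V.eval (α ^ z) = ∑ i ∈ Finset.range n, (β * α ^ z) ^ i := by
      rw [← Fin.sum_univ_eq_sum_range]
      simp [hV, wordPoly, eval_finsetSum, mul_pow]
    have h2 : β * α ^ z - 1 ≠ 0 := by
      rw [sub_ne_zero, hβ, ← pow_add]
      exact fun h => hw z hz ((hα.pow_eq_one_iff_dvd _).1 h)
    rw [h1]
    refine (mul_eq_zero.1 ((geom_sum_mul _ _).trans ?_)).resolve_right h2
    rw [hβ, ← pow_add, ← pow_mul, mul_comm, pow_mul, hα.pow_eq_one, one_pow, sub_self]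
  obtain ⟨f, hf⟩ := hdvd
  let Φ : L[X] →ₗ[L] L :=
    ∑ i : Fin n, algebraMap K L (y i ^ Fintype.card F) • lcoeff L (i : ℕ)
  have hΦ : ∀ p, Φ p = ∑ i : Fin n, algebraMap K L (y i ^ Fintype.card F) * p.coeff i :=
    fun p => by simp [Φ]
  have hVdeg : V.natDegree < n := by
    rw [hV, wordPoly]
    refine (natDegree_sum_le _ _).trans_lt ?_
    rw [Finset.fold_max_lt]
    exact ⟨hn, fun i _ => (natDegree_C_mul_X_pow_le (β ^ (i : ℕ)) _).trans_lt i.2⟩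
  -- V is an L-combination of the codewords g X^j, and Φ, the pairing with y^q, kills each of them.
  have hzero : Φ V = 0 := by
    rw [hf, f.as_sum_range_C_mul_X_pow, Finset.mul_sum, map_sum]
    refine Finset.sum_eq_zero fun j hj => ?_
    rcases eq_or_ne f 0 with rfl | hf0
    · simp
    have hdeg : (g * X ^ j).natDegree < n := by
      refine lt_of_le_of_lt ?_ hVdeg
      rw [hf, (hmon.map (algebraMap K L)).natDegree_mul' hf0, hmon.natDegree_map, hmon.natDegree_mul' (by simp),
        natDegree_X_pow]
      have := Finset.mem_range.1 hj
      omega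
    have hmem : (fun i : Fin n => (g * X ^ j).coeff i) ∈ bchCode K n b δ α := by
      change bchGenerator K n b δ α ∣ (wordPoly _).map (algebraMap K L)
      rw [wordPoly_coeff_of_natDegree_lt hdeg, Polynomial.map_mul, hg]
      exact dvd_mul_right _ _
    have h0 : Φ ((g * X ^ j).map (algebraMap K L)) = 0 := by
      rw [hΦ, ← map_zero (algebraMap K L), ← hy _ hmem, map_sum]
      simp only [coeff_map, map_mul]
    rw [mul_left_comm, ← smul_eq_C_mul, map_smul, ← map_X (algebraMap K L), ← Polynomial.map_pow,
      ← Polynomial.map_mul, h0, smul_zero]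
  let _ : Algebra F L := ((algebraMap K L).comp (algebraMap F K)).toAlgebra
  let φ : L →+* L := (FiniteField.frobeniusAlgHom F L).toRingHom
  have hφ : ∀ x, φ x = x ^ Fintype.card F := fun x => rfl
  -- The q-th power of ∑ y_i α^(wi) is Φ V.
  apply φ.injective
  rw [map_zero, map_sum, ← hzero, hΦ]
  refine Finset.sum_congr rfl fun i _ => ?_
  rw [hV, coeff_wordPoly, hφ, mul_pow, map_pow, hβ, pow_right_comm, pow_mul]

end Duals

/-! ### Dual containment and weight bounds. -/

theorem not_dvd_mul_pow_add_mul_pow {n q m M x y i j : ℕ} (h : q ^ (2 * m) ≡ 1 [MOD n])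
    (hq : 0 < q) (hm : 0 < m) (hM : M * (q ^ m + 1) ≤ n) (hy0 : 0 < y) (hx : x < M) (hy : y < M) :
    ¬ n ∣ x * (q ^ 2) ^ i * q + y * (q ^ 2) ^ j := by
  obtain ⟨k, rfl⟩ : ∃ k, m = k + 1 := ⟨m - 1, by omega⟩
  intro hd
  -- Multiplying by q^(2(ik+k)+1) turns the power q^(2i+1) at x into q^(2m(i+1)) ≡ 1.
  refine not_dvd_add_mul_pow_odd h hq hm hM hy0 hx hy (e := 2 * (j + i * k + k) + 1) ⟨_, rfl⟩
    ((Nat.modEq_zero_iff_dvd).1 ?_)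
  have h1 := ((pow_modEq_one_of_dvd h (dvd_mul_right (2 * (k + 1)) (i + 1))).mul_left x).add_right
    (y * q ^ (2 * (j + i * k + k) + 1))
  rw [mul_one] at h1
  refine h1.symm.trans ((Nat.modEq_zero_iff_dvd).2 ((hd.mul_right (q ^ (2 * (i * k + k) + 1))).trans
    (dvd_of_eq ?_)))
  ring

section Codes

variable {F K L : Type*} [Field F] [Fintype F] [Field K] [Fintype K] [Algebra F K] [Field L]
  [Algebra K L] {q n m M δ : ℕ} {α : L}

theorem hermitianDual_bchCode_le (hF : Fintype.card F = q) (hK : Fintype.card K = q ^ 2)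
    (h : q ^ (2 * m) ≡ 1 [MOD n]) (hm : 0 < m) (hn : 0 < n) (hM : M * (q ^ m + 1) ≤ n)
    (hδ : δ ≤ M) (hα : IsPrimitiveRoot α n) :
    hermitianDual F (bchCode K n 1 δ α) ≤ bchCode K n 1 δ α := by
  have hq : 0 < q := hF ▸ Fintype.card_pos
  intro y hy
  rw [mem_bchCode_iff hα]
  intro z hz
  refine sum_mul_pow_eq_zero_of_mem_hermitianDual hα hn hy fun z' hz' hd => ?_
  rw [hK, mem_bchDefiningSet_one hn] at hz hz'
  obtain ⟨x, hx0, hx, i, rfl⟩ := hz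
  obtain ⟨x', hx0', hx', j, rfl⟩ := hz'
  refine not_dvd_mul_pow_add_mul_pow (i := i) (j := j) h hq hm hM hx0' (hx.trans_le hδ)
    (hx'.trans_le hδ) ((Nat.modEq_zero_iff_dvd).1 ?_)
  rw [hF] at hd
  exact (((Nat.mod_modEq _ _).symm.mul_right q).add (Nat.mod_modEq _ _).symm).trans
    ((Nat.modEq_zero_iff_dvd).2 hd)

theorem le_card_support_of_mem_bchCode (hn : 0 < n) (hδ : 0 < δ) (hα : IsPrimitiveRoot α n)
    (hδn : δ ≤ n) {c : Fin n → K} (hc : c ∈ bchCode K n 1 δ α) (hc0 : c ≠ 0) :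
    δ ≤ Nat.card {i // c i ≠ 0} := by
  rw [mem_bchCode_iff hα] at hc
  have h1 : (fun i => algebraMap K L (c i)) ≠ 0 := fun h0 => hc0 <| funext fun i => by
    simpa using congrFun h0 i
  have h2 := lt_card_support_of_consecutive_zeros (b := 1) (d := δ - 1) hα h1 fun j hj =>
    hc (1 + j) ((mem_bchDefiningSet_one hn).2 ⟨1 + j, by omega, by omega, 0, by
      rw [pow_zero, mul_one, Nat.mod_eq_of_lt (by omega)]⟩)
  simp only [ne_eq, map_eq_zero] at h2 ⊢
  omega

/-- The zeros start at exponent 0, since `not_dvd_mul_pow_add_mul_pow` allows x = 0. This makes M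
consecutive zeros whatever δ ≤ M is, whence purity to M + 1. -/
theorem lt_card_support_of_mem_hermitianDual_bchCode (hF : Fintype.card F = q)
    (hK : Fintype.card K = q ^ 2) (h : q ^ (2 * m) ≡ 1 [MOD n]) (hm : 0 < m) (hn : 0 < n)
    (hM : M * (q ^ m + 1) ≤ n) (hδ : δ ≤ M) (hα : IsPrimitiveRoot α n) {c : Fin n → K}
    (hc : c ∈ hermitianDual F (bchCode K n 1 δ α)) (hc0 : c ≠ 0) :
    M < Nat.card {i // c i ≠ 0} := by
  have hq : 0 < q := hF ▸ Fintype.card_pos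
  have h1 : (fun i => algebraMap K L (c i)) ≠ 0 := fun h0 => hc0 <| funext fun i => by
    simpa using congrFun h0 i
  have h2 := lt_card_support_of_consecutive_zeros (b := 0) (d := M) hα h1 fun w hw => by
    rw [zero_add]
    refine sum_mul_pow_eq_zero_of_mem_hermitianDual hα hn hc fun z' hz' hd => ?_
    rw [hK, mem_bchDefiningSet_one hn] at hz'
    obtain ⟨x', hx0', hx', j, rfl⟩ := hz'
    refine not_dvd_mul_pow_add_mul_pow (i := 0) (j := j) h hq hm hM hx0' hw
      (hx'.trans_le hδ) ((Nat.modEq_zero_iff_dvd).1 ?_)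
    rw [hF] at hd
    rw [pow_zero, mul_one]
    exact ((Nat.mod_modEq _ _).symm.add_left _).trans ((Nat.modEq_zero_iff_dvd).2 hd)
  simpa only [ne_eq, map_eq_zero] using h2

end Codes

/-! ### Error operators and stabilizer codes. -/

section Quantum

variable {F : Type*} [Field F] [Fintype F] {n : ℕ}

theorem exists_traceChar_mul_ne_one {r : F} (hr : r ≠ 0) : ∃ x, traceChar F (x * r) ≠ 1 := by
  let _ : Algebra (ZMod (ringChar F)) F := ZMod.algebra F (ringChar F)
  obtain ⟨x, hx⟩ := FiniteField.trace_to_zmod_nondegenerate F hr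
  refine ⟨x, fun h => hx ?_⟩
  rw [mul_comm]
  apply ZMod.injective_stdAddChar
  rw [AddChar.map_zero_eq_one]
  exact h

theorem errorOp_apply (c : ℂ) (a b : Fin n → F) (ψ : QState F n) (x : Fin n → F) :
    errorOp c a b ψ x = c * (traceChar F (∑ i, b i * (x - a) i) * ψ (x - a)) := rfl

theorem errorOp_eq_smul (c : ℂ) (a b : Fin n → F) : errorOp c a b = c • errorOp 1 a b := by
  rw [errorOp, errorOp, one_smul]

theorem errorOp_one_zero_zero : errorOp 1 (0 : Fin n → F) 0 = LinearMap.id := by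
  ext ψ x
  simp [errorOp_apply]

theorem errorOp_mul (a b a' b' : Fin n → F) (ψ : QState F n) :
    errorOp 1 a b (errorOp 1 a' b' ψ) =
      traceChar F (∑ i, b i * a' i) • errorOp 1 (a + a') (b + b') ψ := by
  ext x
  have h : ∑ i, b i * (x - a) i + ∑ i, b' i * (x - a - a') i =
      ∑ i, b i * a' i + ∑ i, (b + b') i * (x - (a + a')) i := by
    simp only [← Finset.sum_add_distrib, Pi.sub_apply, Pi.add_apply]
    exact Finset.sum_congr rfl fun i _ => by ring
  rw [PiLp.smul_apply, errorOp_apply, errorOp_apply, errorOp_apply, smul_eq_mul, one_mul, one_mul,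
    one_mul, ← mul_assoc, ← mul_assoc, ← AddChar.map_add_eq_mul, ← AddChar.map_add_eq_mul, h,
    sub_sub]

theorem errorOp_comm (a b a' b' : Fin n → F) (ψ : QState F n) :
    errorOp 1 a b (errorOp 1 a' b' ψ) =
      traceChar F (∑ i, b i * a' i - ∑ i, b' i * a i) • errorOp 1 a' b' (errorOp 1 a b ψ) := by
  rw [errorOp_mul, errorOp_mul, smul_smul, ← AddChar.map_add_eq_mul, sub_add_cancel, add_comm a,
    add_comm b]

theorem inner_errorOp_errorOp (a b : Fin n → F) (φ ψ : QState F n) :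
    inner ℂ (errorOp 1 a b φ) (errorOp 1 a b ψ) = inner ℂ φ ψ := by
  rw [PiLp.inner_apply, PiLp.inner_apply, ← Equiv.sum_comp (Equiv.subRight a) fun x => inner ℂ (φ x) (ψ x)]
  refine Finset.sum_congr rfl fun x _ => ?_
  rw [errorOp_apply, errorOp_apply, one_mul, one_mul, ← smul_eq_mul, ← smul_eq_mul,
    inner_smul_left, inner_smul_right, ← mul_assoc, Complex.conj_mul', AddChar.norm_apply]
  simp

theorem norm_errorOp (a b : Fin n → F) (ψ : QState F n) : ‖errorOp 1 a b ψ‖ = ‖ψ‖ := by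
  rw [@norm_eq_sqrt_re_inner ℂ, @norm_eq_sqrt_re_inner ℂ, inner_errorOp_errorOp]

theorem trace_errorOp_zero :
    LinearMap.trace ℂ (QState F n) (errorOp 1 0 0) = (Fintype.card F : ℂ) ^ n := by
  rw [errorOp_one_zero_zero, LinearMap.trace_id]
  simp

/-- If a ≠ 0 the diagonal is zero; if a = 0 the trace is the sum of a nontrivial character of F^n.
-/
theorem trace_errorOp_eq_zero {a b : Fin n → F} (h : a ≠ 0 ∨ b ≠ 0) :
    LinearMap.trace ℂ (QState F n) (errorOp 1 a b) = 0 := by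
  classical
  rw [LinearMap.trace_eq_matrix_trace ℂ (EuclideanSpace.basisFun (Fin n → F) ℂ).toBasis,
    Matrix.trace]
  have hdiag : ∀ x, Matrix.diag (LinearMap.toMatrix (EuclideanSpace.basisFun (Fin n → F) ℂ).toBasis
      (EuclideanSpace.basisFun (Fin n → F) ℂ).toBasis (errorOp 1 a b)) x =
      if a = 0 then traceChar F (∑ i, b i * x i) else 0 := by
    intro x
    rw [Matrix.diag_apply, LinearMap.toMatrix_apply]
    simp only [OrthonormalBasis.coe_toBasis, OrthonormalBasis.coe_toBasis_repr_apply,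
      EuclideanSpace.basisFun_repr, EuclideanSpace.basisFun_apply, errorOp_apply,
      PiLp.single_apply, one_mul]
    split_ifs with ha hb hb
    · simp [hb]
    · simp_all
    · simp_all
    · simp
  simp_rw [hdiag]
  split_ifs with ha
  · have hb : b ≠ 0 := h.resolve_left (not_not.2 ha)
    obtain ⟨i, hi⟩ := Function.ne_iff.1 hb
    obtain ⟨r, hr⟩ := exists_traceChar_mul_ne_one hi
    let ψ : AddChar (Fin n → F) ℂ := (traceChar F).compAddMonoidHom
      { toFun := fun x => ∑ i, b i * x i
        map_zero' := by simp
        map_add' := fun x y => by simp [mul_add, Finset.sum_add_distrib] }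
    have hψ : ∀ x, ψ x = traceChar F (∑ i, b i * x i) := fun x => rfl
    refine AddChar.sum_eq_zero_of_ne_one (ψ := ψ) fun h0 => hr ?_
    have h1 : ψ (Pi.single i r) = 1 := by rw [h0, AddChar.one_apply]
    rw [← h1, hψ, Finset.sum_eq_single i (fun j _ hj => by simp [hj]) (by simp),
      Pi.single_eq_same, mul_comm]
  · simp

/-- A commuting family of endomorphisms of a nonzero finite-dimensional space over an
algebraically closed field has a common eigenvector. -/
theorem exists_common_eigenvector {k V ι : Type*} [Field k] [IsAlgClosed k] [AddCommGroup V]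
    [Module k V] [FiniteDimensional k V] [Nontrivial V] (f : ι → Module.End k V)
    (hf : ∀ i j, Commute (f i) (f j)) : ∃ v ≠ 0, ∀ i, ∃ μ : k, f i v = μ • v := by
  -- On a minimal nonzero invariant subspace each f i is scalar, because its eigenspaces there are
  -- again invariant.
  let good : Set (Submodule k V) := {W | W ≠ ⊥ ∧ ∀ i, ∀ w ∈ W, f i w ∈ W}
  obtain ⟨W, ⟨hW0, hWf⟩, hmin⟩ := WellFounded.has_min (wellFounded_lt (α := Submodule k V)) good
    ⟨⊤, top_ne_bot, fun _ _ _ => trivial⟩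
  obtain ⟨v, hvW, hv0⟩ := (Submodule.ne_bot_iff W).1 hW0
  refine ⟨v, hv0, fun i => ?_⟩
  have : Nontrivial W := (Submodule.nontrivial_iff_ne_bot).2 hW0
  obtain ⟨μ, hμ⟩ := Module.End.exists_eigenvalue ((f i).restrict (hWf i))
  obtain ⟨w, hw⟩ := hμ.exists_hasEigenvector
  refine ⟨μ, ?_⟩
  have hle : W ⊓ (f i).eigenspace μ ∈ good := by
    constructor
    · refine (Submodule.ne_bot_iff _).2 ⟨w, ⟨w.2, ?_⟩, fun h0 => hw.2 (Subtype.ext h0)⟩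
      exact Module.End.mem_eigenspace_iff.2 (congrArg Subtype.val hw.apply_eq_smul)
    · rintro j x ⟨hx, hx'⟩
      refine ⟨hWf j x hx, Module.End.mem_eigenspace_iff.2 ?_⟩
      have h1 := LinearMap.congr_fun (hf i j) x
      simp only [Module.End.mul_apply] at h1
      rw [h1, Module.End.mem_eigenspace_iff.1 hx', map_smul]
  have heq : W ⊓ (f i).eigenspace μ = W := by
    by_contra hne
    exact hmin _ hle (lt_of_le_of_ne inf_le_left hne)
  exact Module.End.mem_eigenspace_iff.1 (heq.ge hvW).2

/-- An isotropic subspace for the symplectic form on `F ^ n × F ^ n` gives rise to a stabilizer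
code. -/
theorem exists_stabilizerCode_of_isotropic (S : Submodule F ((Fin n → F) × (Fin n → F)))
    (hS : ∀ s ∈ S, ∀ t ∈ S, ∑ i, s.2 i * t.1 i = ∑ i, t.2 i * s.1 i) :
    ∃ Q : Submodule ℂ (QState F n), IsStabilizerCode Q ∧
      Module.finrank ℂ Q * Nat.card S = Fintype.card F ^ n ∧
      (∀ a b, (∃ c, errorOp c a b ∈ codeStabilizer Q) ↔ (a, b) ∈ S) ∧
      ∀ a b, (∃ s ∈ S, ∑ i, s.2 i * a i ≠ ∑ i, b i * s.1 i) →
        ∀ u ∈ Q, ∀ v ∈ Q, inner ℂ u (errorOp 1 a b v) = 0 := by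
  classical
  have := Fintype.ofFinite S
  obtain ⟨v₀, hv₀, hev⟩ := exists_common_eigenvector
    (fun s : S => (errorOp 1 s.1.1 s.1.2 : QState F n →ₗ[ℂ] QState F n)) fun s t => by
      ext1 ψ
      simp only [Module.End.mul_apply]
      rw [errorOp_comm, hS s s.2 t t.2, sub_self, AddChar.map_zero_eq_one, one_smul]
  -- The eigenvalues at v₀ choose the phases consistently: the operators μ(s)⁻¹ X(a)Z(b) form a
  -- group, so their joint fixed space contains v₀.
  choose μ hμ using hev
  have hμn : ∀ s, ‖μ s‖ = 1 := fun s => by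
    have h := norm_errorOp s.1.1 s.1.2 v₀
    rw [hμ, norm_smul] at h
    exact mul_right_cancel₀ (norm_ne_zero_iff.2 hv₀) (h.trans (one_mul _).symm)
  have hμ0 : ∀ s, μ s ≠ 0 := fun s => norm_ne_zero_iff.1 (by rw [hμn]; exact one_ne_zero)
  have hμmul : ∀ s t : S, μ s * μ t = traceChar F (∑ i, s.1.2 i * t.1.1 i) * μ (s + t) := by
    intro s t
    have h := errorOp_mul s.1.1 s.1.2 t.1.1 t.1.2 v₀
    rw [hμ, map_smul, hμ, smul_smul, mul_comm] at h
    have h2 := hμ (s + t)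
    simp only [Submodule.coe_add, Prod.fst_add, Prod.snd_add] at h2
    rw [h2, smul_smul] at h
    exact smul_left_injective ℂ hv₀ h
  have hμ1 : μ 0 = 1 := by
    have h := hμ 0
    simp only [Submodule.coe_zero, Prod.fst_zero, Prod.snd_zero, errorOp_one_zero_zero,
      LinearMap.id_apply] at h
    exact smul_left_injective ℂ hv₀ (h.symm.trans (one_smul ℂ v₀).symm)
  let Q : Submodule ℂ (QState F n) :=
    ⨅ s : S, LinearMap.ker (errorOp 1 s.1.1 s.1.2 - μ s • LinearMap.id)
  have hQ : ∀ v, v ∈ Q ↔ ∀ s : S, errorOp 1 s.1.1 s.1.2 v = μ s • v := fun v => by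
    simp [Q, Submodule.mem_iInf, sub_eq_zero]
  have hv₀Q : v₀ ∈ Q := (hQ _).2 hμ
  have hstab : ∀ s : S, errorOp (μ s)⁻¹ s.1.1 s.1.2 ∈ codeStabilizer Q := fun s =>
    ⟨⟨_, _, _, by rw [norm_inv, hμn, inv_one], rfl⟩, fun v hv => by
      rw [errorOp_eq_smul, LinearMap.smul_apply, (hQ v).1 hv s, inv_smul_smul₀ (hμ0 s)]⟩
  have hcard : (Fintype.card S : ℂ) ≠ 0 := Nat.cast_ne_zero.2 Fintype.card_ne_zero
  -- The average over this group projects onto Q. Only s = 0 contributes to its trace, so dim Q =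
  -- q^n / |S|.
  let P : QState F n →ₗ[ℂ] QState F n :=
    (Fintype.card S : ℂ)⁻¹ • ∑ s : S, (μ s)⁻¹ • errorOp 1 s.1.1 s.1.2
  have hP : ∀ v, P v = (Fintype.card S : ℂ)⁻¹ • ∑ s : S, (μ s)⁻¹ • errorOp 1 s.1.1 s.1.2 v :=
    fun v => by simp [P, LinearMap.sum_apply]
  have hproj : LinearMap.IsProj Q P := by
    constructor
    · intro v
      rw [hQ]
      intro t
      rw [hP, map_smul, map_sum, smul_comm]
      congr 1
      rw [Finset.smul_sum]
      conv_rhs => rw [← Equiv.sum_comp (Equiv.addLeft t)]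
      refine Finset.sum_congr rfl fun s _ => ?_
      rw [map_smul, errorOp_mul, smul_smul, smul_smul]
      simp only [Equiv.coe_addLeft, Submodule.coe_add, Prod.fst_add, Prod.snd_add]
      congr 1
      have := hμmul t s
      field_simp [hμ0]
      linear_combination -this
    · intro v hv
      rw [hP]
      have : ∀ s : S, (μ s)⁻¹ • errorOp 1 s.1.1 s.1.2 v = v := fun s => by
        rw [(hQ v).1 hv s, inv_smul_smul₀ (hμ0 s)]
      simp only [this, Finset.sum_const, Finset.card_univ]
      rw [← Nat.cast_smul_eq_nsmul ℂ, inv_smul_smul₀ hcard]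
  have hrank : (Module.finrank ℂ Q : ℂ) * Fintype.card S = (Fintype.card F : ℂ) ^ n := by
    have h1 := hproj.trace
    simp only [P, map_smul, map_sum] at h1
    rw [Finset.sum_eq_single 0] at h1
    · simp only [Submodule.coe_zero, Prod.fst_zero, Prod.snd_zero, trace_errorOp_zero, hμ1] at h1
      rw [← h1]
      simp only [smul_eq_mul]
      field_simp
    · intro s _ hs
      rw [trace_errorOp_eq_zero, smul_zero]
      by_contra! h0
      exact hs (Subtype.ext (Prod.ext h0.1 h0.2))
    · simp
  refine ⟨Q, ⟨fun h => hv₀ ((Submodule.mem_bot ℂ).1 (h ▸ hv₀Q)), fun v => ⟨fun hv E hE => hE.2 v hv,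
    fun hv => (hQ v).2 fun s => ?_⟩⟩, ?_, fun a b => ⟨?_, fun h => ⟨_, hstab ⟨(a, b), h⟩⟩⟩, ?_⟩
  · have h := hv _ (hstab s)
    rw [errorOp_eq_smul, LinearMap.smul_apply] at h
    rw [← smul_inv_smul₀ (hμ0 s) (errorOp 1 s.1.1 s.1.2 v), h]
  · rw [Nat.card_eq_fintype_card]
    exact_mod_cast hrank
  · rintro ⟨c, -, hc⟩
    by_contra hab
    -- For (a, b) outside S no (a, b) + s vanishes, so the left side has trace 0, while the trace of
    -- P is dim Q ≠ 0.
    have h1 : errorOp c a b ∘ₗ P = P := by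
      ext1 v
      exact hc _ (hproj.map_mem v)
    have h2 : LinearMap.trace ℂ _ (errorOp c a b ∘ₗ P) = 0 := by
      have h3 : errorOp c a b ∘ₗ P = (Fintype.card S : ℂ)⁻¹ • ∑ s : S,
          (c * (μ s)⁻¹ * traceChar F (∑ i, b i * s.1.1 i)) •
            errorOp 1 (a + s.1.1) (b + s.1.2) := by
        ext1 v
        rw [LinearMap.comp_apply, hP, map_smul, map_sum, LinearMap.smul_apply, LinearMap.sum_apply]
        congr 1
        refine Finset.sum_congr rfl fun s _ => ?_
        rw [map_smul, errorOp_eq_smul c, LinearMap.smul_apply, errorOp_mul, smul_smul, smul_smul,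
          LinearMap.smul_apply]
        congr 1
        ring
      rw [h3, map_smul, map_sum, Finset.sum_eq_zero, smul_zero]
      intro s _
      rw [map_smul, trace_errorOp_eq_zero, smul_zero]
      by_contra! h0
      refine hab ?_
      have : (a, b) = -s.1 := Prod.ext (eq_neg_of_add_eq_zero_left h0.1)
        (eq_neg_of_add_eq_zero_left h0.2)
      rw [this]
      exact S.neg_mem s.2
    rw [h1, hproj.trace] at h2
    rw [h2, zero_mul] at hrank
    exact pow_ne_zero n (Nat.cast_ne_zero.2 Fintype.card_ne_zero) hrank.symm
  · rintro a b ⟨s, hs, hne⟩ u hu v hv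
    obtain ⟨r, hr⟩ := exists_traceChar_mul_ne_one (sub_ne_zero.2 hne)
    -- A nonzero symplectic product may have trace 0; F-linearity of S permits rescaling s until the
    -- commutation phase is not 1.
    set t : S := ⟨r • s, S.smul_mem r hs⟩ with ht
    have h1 := inner_errorOp_errorOp t.1.1 t.1.2 u (errorOp 1 a b v)
    have h2 : ∑ i, t.1.2 i * a i - ∑ i, b i * t.1.1 i =
        r * (∑ i, s.2 i * a i - ∑ i, b i * s.1 i) := by
      simp only [ht, Prod.smul_fst, Prod.smul_snd, Pi.smul_apply, smul_eq_mul, mul_sub,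
        Finset.mul_sum, mul_assoc, mul_left_comm]
    rw [errorOp_comm, (hQ u).1 hu, (hQ v).1 hv, map_smul, inner_smul_left, inner_smul_right,
      inner_smul_right, h2] at h1
    have h3 : (starRingEnd ℂ) (μ t) * μ t = 1 := by
      rw [Complex.conj_mul', hμn]
      simp
    have h4 : (traceChar F (r * (∑ i, s.2 i * a i - ∑ i, b i * s.1 i)) - 1) *
        inner ℂ u (errorOp 1 a b v) = 0 := by
      linear_combination h1 - traceChar F (r * (∑ i, s.2 i * a i - ∑ i, b i * s.1 i)) *
        inner ℂ u (errorOp 1 a b v) * h3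
    exact (mul_eq_zero.1 h4).resolve_left (sub_ne_zero.2 hr)

end Quantum

/-! ### From Hermitian to symplectic orthogonality. -/

section HermitianConstruction

theorem frobenius_sq_sub_sq_ne_zero {F K : Type*} [Field F] [Fintype F] [Field K] [Algebra F K]
    {β : K} (hβ : LinearIndependent F ![β, β ^ Fintype.card F]) :
    (β ^ Fintype.card F) ^ 2 - β ^ 2 ≠ 0 := by
  have h := LinearIndependent.pair_iff.1 hβ
  rw [sq_sub_sq]
  refine mul_ne_zero (fun h0 => ?_) fun h0 => ?_
  · have := h 1 1 (by rw [one_smul, one_smul, add_comm, h0])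
    exact one_ne_zero this.1
  · have := h (-1) 1 (by rw [neg_smul, one_smul, one_smul, neg_add_eq_sub, h0])
    exact one_ne_zero this.2

variable {F K : Type*} [Field F] [Fintype F] [Field K] [Fintype K] [Algebra F K]

/-- Take β to be a generator ζ of Kˣ. Dependence would put ζ^(q-1) in F, so ζ^((q-1)²) = 1, although
(q-1)² < q² - 1. -/
theorem exists_linearIndependent_frobenius_pair (hK : Fintype.card K = Fintype.card F ^ 2) :
    ∃ β : K, LinearIndependent F ![β, β ^ Fintype.card F] := by
  classical
  obtain ⟨ζ, hζ⟩ := IsCyclic.exists_generator (α := Kˣ)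
  have hord : orderOf ζ = Fintype.card F ^ 2 - 1 := by
    rw [orderOf_eq_card_of_forall_mem_zpowers hζ, Nat.card_eq_fintype_card, Fintype.card_units, hK]
  have hF : 1 < Fintype.card F := Fintype.one_lt_card
  obtain ⟨r, hr⟩ : ∃ r, Fintype.card F = r + 2 := ⟨Fintype.card F - 2, by omega⟩
  refine ⟨ζ, LinearIndependent.pair_iff.2 fun s t hst => ?_⟩
  have hζ0 : (ζ : K) ≠ 0 := ζ.ne_zero
  by_cases ht : t = 0
  · subst ht
    simpa [hζ0] using hst
  exfalso
  have h1 : (ζ : K) ^ (r + 1) = algebraMap F K (-s / t) := by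
    have ht' : algebraMap F K t ≠ 0 := by simpa using ht
    rw [map_div₀, eq_div_iff ht', map_neg]
    apply mul_right_cancel₀ hζ0
    rw [Algebra.smul_def, Algebra.smul_def, hr] at hst
    linear_combination hst
  have h2 : -s / t ≠ 0 := fun h => by
    rw [h, map_zero] at h1
    exact pow_ne_zero _ hζ0 h1
  have h3 : ζ ^ ((r + 1) * (r + 1)) = 1 := by
    ext
    have h4 := FiniteField.pow_card_sub_one_eq_one _ h2
    rw [hr, Nat.add_sub_assoc (by norm_num)] at h4
    rw [Units.val_pow_eq_pow_val, pow_mul, h1, ← map_pow, h4, map_one, Units.val_one]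
  have h5 := Nat.le_of_dvd (by positivity) (orderOf_dvd_of_pow_eq_one h3)
  rw [hord, hr] at h5
  have h6 : (r + 2) ^ 2 = (r + 1) * (r + 1) + 2 * r + 3 := by ring
  omega

variable {n : ℕ}

/-- The word `β a + β ^ q b` of the error `X(a) Z(b)`. -/
def errorWord (β : K) : ((Fin n → F) × (Fin n → F)) →ₗ[F] (Fin n → K) where
  toFun s i := s.1 i • β + s.2 i • β ^ Fintype.card F
  map_add' s t := by
    ext i
    simp only [Prod.fst_add, Prod.snd_add, Pi.add_apply, add_smul]
    abel
  map_smul' r s := by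
    ext i
    simp [smul_smul]

theorem errorWord_apply (β : K) (s : (Fin n → F) × (Fin n → F)) (i : Fin n) :
    errorWord β s i = s.1 i • β + s.2 i • β ^ Fintype.card F := rfl

theorem errorWord_ne_zero_iff {β : K} (hβ : LinearIndependent F ![β, β ^ Fintype.card F])
    (s : (Fin n → F) × (Fin n → F)) (i : Fin n) :
    errorWord β s i ≠ 0 ↔ s.1 i ≠ 0 ∨ s.2 i ≠ 0 := by
  rw [← not_iff_not, not_or, not_not, not_not, not_not, errorWord_apply]
  exact ⟨LinearIndependent.pair_iff.1 hβ _ _, fun h => by simp [h.1, h.2]⟩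

theorem errorWeight_eq_card_support {β : K} (hβ : LinearIndependent F ![β, β ^ Fintype.card F])
    (a b : Fin n → F) :
    errorWeight a b = Nat.card {i // errorWord β (a, b) i ≠ 0} :=
  Nat.card_congr (Equiv.subtypeEquivRight fun i => (errorWord_ne_zero_iff hβ (a, b) i).symm)

theorem errorWord_injective {β : K} (hβ : LinearIndependent F ![β, β ^ Fintype.card F]) :
    Function.Injective (errorWord β : ((Fin n → F) × (Fin n → F)) →ₗ[F] (Fin n → K)) := by
  rw [injective_iff_map_eq_zero]
  intro s hs
  have h : ∀ i, s.1 i = 0 ∧ s.2 i = 0 := fun i => by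
    have := (errorWord_ne_zero_iff hβ s i).not
    rw [hs] at this
    simpa using this
  exact Prod.ext (funext fun i => (h i).1) (funext fun i => (h i).2)

theorem errorWord_bijective {β : K} (hβ : LinearIndependent F ![β, β ^ Fintype.card F])
    (hK : Fintype.card K = Fintype.card F ^ 2) :
    Function.Bijective (errorWord β : ((Fin n → F) × (Fin n → F)) →ₗ[F] (Fin n → K)) := by
  rw [Fintype.bijective_iff_injective_and_card]
  refine ⟨errorWord_injective hβ, ?_⟩
  rw [Fintype.card_prod, Fintype.card_fun, Fintype.card_fun, Fintype.card_fin, hK]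
  ring

/-- Raising to the power q exchanges β and β^q, so the terms symmetric in s and t cancel. -/
theorem hermitian_sub_swap_eq {β : K} (hK : Fintype.card K = Fintype.card F ^ 2)
    (s t : (Fin n → F) × (Fin n → F)) :
    ∑ i, errorWord β s i ^ Fintype.card F * errorWord β t i -
      ∑ i, errorWord β t i ^ Fintype.card F * errorWord β s i =
    algebraMap F K (∑ i, t.2 i * s.1 i - ∑ i, s.2 i * t.1 i) *
      ((β ^ Fintype.card F) ^ 2 - β ^ 2) := by
  have hpow : ∀ (s : (Fin n → F) × (Fin n → F)) i, errorWord β s i ^ Fintype.card F =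
      algebraMap F K (s.1 i) * β ^ Fintype.card F + algebraMap F K (s.2 i) * β := by
    intro s i
    change FiniteField.frobeniusAlgHom F K (errorWord β s i) = _
    rw [errorWord_apply, map_add, map_smul, map_smul, Algebra.smul_def, Algebra.smul_def]
    change _ * β ^ Fintype.card F + _ * (β ^ Fintype.card F) ^ Fintype.card F = _
    rw [← pow_mul, ← sq, ← hK, FiniteField.pow_card]
  simp_rw [hpow, errorWord_apply, Algebra.smul_def]
  rw [← Finset.sum_sub_distrib, ← Finset.sum_sub_distrib, map_sum, Finset.sum_mul]
  refine Finset.sum_congr rfl fun i _ => ?_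
  rw [map_sub, map_mul, map_mul]
  ring

/-- The Hermitian construction: a code that contains its Hermitian dual gives a stabilizer code. -/
theorem exists_hermitianConstruction {β : K} (hβ : LinearIndependent F ![β, β ^ Fintype.card F])
    (hK : Fintype.card K = Fintype.card F ^ 2)
    (D : Submodule K (Fin n → K)) (hD : hermitianDual F D ≤ D) :
    ∃ Q : Submodule ℂ (QState F n), IsStabilizerCode Q ∧
      Module.finrank ℂ Q * Nat.card (hermitianDual F D) = Fintype.card F ^ n ∧
      (∀ a b, (∃ c, errorOp c a b ∈ codeStabilizer Q) ↔
        errorWord β (a, b) ∈ hermitianDual F D) ∧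
      ∀ a b, errorWord β (a, b) ∉ D → ∀ u ∈ Q, ∀ v ∈ Q, inner ℂ u (errorOp 1 a b v) = 0 := by
  have hbij := errorWord_bijective (n := n) hβ hK
  obtain ⟨Q, hQ, hrank, hstab, hdet⟩ := exists_stabilizerCode_of_isotropic
    (((hermitianDual F D).restrictScalars F).comap (errorWord β)) fun s hs t ht => by
      have h := hermitian_sub_swap_eq (β := β) hK s t
      rw [hs _ (hD ht), ht _ (hD hs), sub_self, eq_comm] at h
      have h2 := (mul_eq_zero.1 h).resolve_right (frobenius_sq_sub_sq_ne_zero hβ)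
      rw [map_eq_zero, sub_eq_zero] at h2
      exact h2.symm
  refine ⟨Q, hQ, ?_, hstab, fun a b hab => hdet a b ?_⟩
  · rw [← hrank]
    congr 1
    exact Nat.card_congr ((Equiv.ofBijective _ hbij).subtypeEquiv fun s => Iff.rfl).symm
  · by_contra! hcon
    apply hab
    rw [← hermitianDual_hermitianDual (F := F) hK D]
    have hsymm : ∀ y ∈ hermitianDual F D,
        ∑ i, errorWord β (a, b) i ^ Fintype.card F * y i =
          ∑ i, y i ^ Fintype.card F * errorWord β (a, b) i := by
      intro y hy
      obtain ⟨s, rfl⟩ := hbij.2 y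
      have h := hermitian_sub_swap_eq (β := β) hK (a, b) s
      rw [hcon s hy, sub_self, map_zero, zero_mul, sub_eq_zero] at h
      exact h
    intro y hy
    -- The symplectic condition gives only symmetry of the Hermitian product. Applied to both y and
    -- βy, it yields (β^q - β) times the product equal to 0.
    have h1 := hsymm (β • y) (Submodule.smul_mem _ _ hy)
    simp only [Pi.smul_apply, smul_eq_mul, mul_pow, mul_assoc, mul_left_comm _ β] at h1
    rw [← Finset.mul_sum, ← Finset.mul_sum, ← hsymm y hy] at h1
    have h2 : (β ^ Fintype.card F - β) *
        ∑ i, errorWord β (a, b) i ^ Fintype.card F * y i = 0 := by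
      linear_combination -h1
    refine (mul_eq_zero.1 h2).resolve_left fun h3 => ?_
    refine frobenius_sq_sub_sq_ne_zero hβ ?_
    rw [sub_eq_zero.1 h3, sub_self]

end HermitianConstruction

/-! ### Parameters and conclusion. -/

theorem floor_mul_le {n q m : ℕ} (hq : 2 ≤ q) (hm : 0 < m) :
    ⌊(n : ℚ) * ((q : ℚ) ^ m - 1) / ((q : ℚ) ^ (2 * m) - 1)⌋₊ * (q ^ m + 1) ≤ n := by
  have h1 : (1 : ℚ) < (q : ℚ) ^ m := one_lt_pow₀ (by exact_mod_cast hq) hm.ne'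
  have h2 : (n : ℚ) * ((q : ℚ) ^ m - 1) / ((q : ℚ) ^ (2 * m) - 1) = n / ((q : ℚ) ^ m + 1) := by
    have h3 : (q : ℚ) ^ m - 1 ≠ 0 := by linarith
    have h4 : (q : ℚ) ^ m + 1 ≠ 0 := by linarith
    have h5 : (q : ℚ) ^ (2 * m) - 1 = (q ^ m - 1) * (q ^ m + 1) := by ring
    rw [h5]
    field_simp
  rw [h2]
  have h6 := Nat.floor_le (show (0 : ℚ) ≤ n / ((q : ℚ) ^ m + 1) by positivity)
  rw [le_div_iff₀ (by positivity)] at h6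
  exact_mod_cast h6

theorem natCast_ne_zero_of_pow_modEq_one {F K : Type*} [Field F] [Fintype F] [Field K]
    [Algebra F K] {n e : ℕ} (he : e ≠ 0) (h : Fintype.card F ^ e ≡ 1 [MOD n]) : (n : K) ≠ 0 := by
  intro hn
  obtain ⟨c, hc⟩ := Nat.modEq_iff_dvd.1 h
  have h1 := congrArg (Int.cast : ℤ → K) hc
  have h2 : (Fintype.card F : K) = 0 := by
    rw [← map_natCast (algebraMap F K), FiniteField.cast_card_eq_zero, map_zero]
  push_cast at h1
  rw [h2, hn, zero_pow he] at h1
  simp at h1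

theorem mainTheorem11 {F K : Type*} [Field F] [Fintype F] [Field K] [Fintype K] [Algebra F K]
    (q n m δ δmax : ℕ) (hF : Fintype.card F = q) (hK : Fintype.card K = q ^ 2)
    (hm : m = orderOf ((q : ZMod n) ^ 2)) (hm2 : 2 ≤ m)
    (hδmax : δmax = ⌊(n : ℚ) * ((q : ℚ) ^ m - 1) / ((q : ℚ) ^ (2 * m) - 1)⌋₊)
    (hδ2 : 2 ≤ δ) (hδ : δ ≤ δmax) :
    ∃ D : Submodule K (Fin n → K), IsNarrowSenseBCH n δ D ∧ hermitianDual F D ≤ D ∧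
      ∃ (k : ℕ) (Q : Submodule ℂ (QState F n)),
        (k : ℤ) = (n : ℤ) - 2 * m * ⌈((δ : ℚ) - 1) * (1 - 1 / (q : ℚ) ^ 2)⌉ ∧
        IsStabilizerCode Q ∧ Module.finrank ℂ Q = q ^ k ∧ MinDistAtLeast Q δ ∧
        PureTo Q (δmax + 1) ∧ IsHermitianConstruction D Q := by
  have hq : 2 ≤ q := hF ▸ Fintype.one_lt_card
  have hm0 : 0 < m := by omega
  have hM : δmax * (q ^ m + 1) ≤ n := hδmax ▸ floor_mul_le hq hm0
  have hMn : δmax ≤ n := (Nat.le_mul_of_pos_right _ (Nat.succ_pos _)).trans hM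
  have hn : 0 < n := by omega
  -- `orderOf` is 0 when no positive power is 1, so m ≥ 2 already encodes gcd(n, q) = 1.
  have hord : (q ^ 2) ^ m ≡ 1 [MOD n] := by
    rw [← ZMod.natCast_eq_natCast_iff]
    push_cast
    rw [hm, pow_orderOf_eq_one]
  have hord' : q ^ (2 * m) ≡ 1 [MOD n] := by rwa [pow_mul]
  have hnK : NeZero (n : K) :=
    ⟨natCast_ne_zero_of_pow_modEq_one (F := F) (e := 2 * m) (by omega) (hF.symm ▸ hord')⟩
  obtain ⟨α, hα⟩ := HasEnoughRootsOfUnity.exists_primitiveRoot (AlgebraicClosure K) n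
  have hK' : Fintype.card K = Fintype.card F ^ 2 := hF.symm ▸ hK
  set D := bchCode K n 1 δ α with hDdef
  have hD : hermitianDual F D ≤ D := hermitianDual_bchCode_le hF hK hord' hm0 hn hM hδ hα
  obtain ⟨β, hβ⟩ := exists_linearIndependent_frobenius_pair hK'
  obtain ⟨Q, hQ, hrank, hstab, hdet⟩ := exists_hermitianConstruction hβ hK' D hD
  set N := (bchDefiningSet n (Fintype.card K) 1 δ).card with hN
  have hr1 : Module.finrank K D + N = n := finrank_bchCode hα hn
  have hr2 := finrank_add_finrank_hermitianDual (F := F) D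
  -- The dual has dimension N and D has dimension n - N, so 2N ≤ n and the subtraction in k = n - 2N
  -- is not truncated.
  have hr3 := Submodule.finrank_mono hD
  have hdet' : ∀ a b : Fin n → F, errorWeight a b < δ → (a, b) ≠ 0 →
      ∀ u ∈ Q, ∀ v ∈ Q, inner ℂ u (errorOp 1 a b v) = 0 := by
    intro a b hw h0
    refine hdet a b fun hmem => ?_
    have := le_card_support_of_mem_bchCode hn (by omega) hα (hδ.trans hMn) hmem
      ((map_ne_zero_iff _ (errorWord_injective hβ)).2 h0)
    rw [errorWeight_eq_card_support hβ] at hw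
    omega
  refine ⟨D, ⟨α, hα, hDdef⟩, hD, n - 2 * N, Q, ?_, hQ, ?_, ⟨fun a b hw => ?_, ?_⟩, ?_,
    β, hβ, hstab⟩
  · have hcard := card_bchDefiningSet_one hord hq hm0 hM hδ hn
    rw [← hK, ← hN, hK] at hcard
    have hceil := ceil_mul_one_sub_one_div δ (q ^ 2) (by omega)
    push_cast at hceil
    rw [hceil, Nat.cast_sub (by omega), hcard]
    push_cast
    ring
  · rw [Module.natCard_eq_pow_finrank (K := K), Nat.card_eq_fintype_card, hK, hF, ← pow_mul] at hrank
    apply Nat.eq_of_mul_eq_mul_right (pow_pos (by omega : 0 < q)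
      (2 * Module.finrank K (hermitianDual F D)))
    rw [hrank, ← pow_add]
    congr 1
    omega
  · by_cases h0 : (a, b) = 0
    · obtain ⟨rfl, rfl⟩ := Prod.mk_eq_zero.1 h0
      exact ⟨1, fun u _ v _ => by rw [errorOp_one_zero_zero, one_mul, LinearMap.id_apply]⟩
    · exact ⟨0, fun u hu v hv => by rw [hdet' a b hw h0 u hu v hv, zero_mul]⟩
  · intro _ a b hpos hw
    refine hdet' a b hw fun h0 => ?_
    obtain ⟨rfl, rfl⟩ := Prod.mk_eq_zero.1 h0
    simp [errorWeight] at hpos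
  · intro c a b hc h0
    rw [errorWeight_eq_card_support hβ]
    refine lt_card_support_of_mem_hermitianDual_bchCode hF hK hord' hm0 hn hM hδ hα
      ((hstab a b).1 ⟨c, hc⟩) ((map_ne_zero_iff _ (errorWord_injective hβ)).2 fun h => ?_)
    obtain ⟨rfl, rfl⟩ := Prod.mk_eq_zero.1 h
    simp at h0
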